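/- Let $N\ge 1$, let $I_1,\dots,I_N$ and $R_1,\dots,R_N$ be positive integers with $R_{N+1}=R_1$, let $\mathcal X\in\mathbb R^{I_1\times\cdots\times I_N}$ be a tensor and let $\mathcal G_j\in\mathbb R^{R_j\times I_j\times R_{j+1}}$ be tensor-ring cores with lateral slices $\mathbf G_j(i_j)\in\mathbb R^{R_j\times R_{j+1}}$. Fix $n\in\{1,\dots,N\}$. Index rows by the multi-indices $(i_j)_{j\ne n}$, $1\le i_j\le I_j$. Let $\mathbf G^{\neq n}_{[2]}$ be the $\prod_{j\ne n}I_j\times R_nR_{n+1}$ matrix whose entry in row $(i_j)_{j\neq n}$ and column $(r_n,r_{n+1})$ is the $(r_{n+1},r_n)$ entry of $\mathbf G_{n+1}(i_{n+1})\cdots\mathbf G_N(i_N)\,\mathbf G_1(i_1)\cdots\mathbf G_{n-1}(i_{n-1})$, and let $\mathbf X_{[n]}^{\intercal}$ be the $\prod_{j\ne n}I_j\times I_n$ matrix whose entry in row $(i_j)_{j\ne n}$ and column $i_n$ is $\mathcal X(i_1,\dots,i_N)$. A TensorSketch $\mathbf T_{\ne n}$ with $m$ rows is the random $m\times\prod_{j\neq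 n}I_j$ matrix whose column at $(i_j)_{j\ne n}$ has the single nonzero entry $\prod_{j\ne n}S_j(i_j)$, placed in row $\bigl(\sum_{j\ne n}(H_j(i_j)-1)\bmod m\bigr)+1$. Here, for each $j\neq n$, $H_j:\{1,\dots,I_j\}\to\{1,\dots,m\}$ is a $3$-wise independent random hash map and $S_j:\{1,\dots,I_j\}\to\{-1,1\}$ is a $4$-wise independent one ($k$-wise independent means that each key has a uniformly distributed value and the values of any at most $k$ distinct keys are independent), and all these maps are mutually independent. There are absolute constants $C,K>0$ such that the following holds for all such data, all $\varepsilon,\eta\in(0,1)$ and all integers $$m\ \ge\ C\,\frac{R_nR_{n+1}\,3^{N-1}\,\bigl(R_nR_{n+1}+1/\varepsilon^2\bigr)}{\eta}.$$ Let $$\mathrm{opt}=\min_{\mathbf Z\in\mathbb R^{R_nR_{n+1}\times I_n}}\|\mathbf G^{\ne n}_{[2]}\mathbf Z-\mathbf X_{[n]}^{\intercal}\|_F .$$ Both this minimum and, for every outcome, the minimum of the sketched objective $\|\mathbf T_{\ne n}\mathbf G^{\ne n}_{[2]}\mathbf Z-\mathbf T_{\ne n}\mathbf X_{[n]}^{\intercal}\|_F$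 over $\mathbf Z\in\mathbb R^{R_nR_{n+1}\times I_n}$ are attained, and with probability at least $1-\eta$ every minimizer $\tilde{\mathbf Z}$ of the sketched objective satisfies $$(1-K\varepsilon)\,\mathrm{opt}\ \le\ \|\mathbf G^{\ne n}_{[2]}\tilde{\mathbf Z}-\mathbf X_{[n]}^{\intercal}\|_F\ \le\ (1+K\varepsilon)\,\mathrm{opt}.$$ -/

import Mathlib

open MeasureTheory ProbabilityTheory
open scoped ENNReal

/-- The position reached from `j` after `k` steps to the right on the ring of `N` positions. -/
def ringPos {N : ℕ} [NeZero N] (j : Fin N) : ℕ → Fin N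
  | 0 => j
  | k + 1 => ringPos j k + 1

theorem ringPos_eq {N : ℕ} [NeZero N] (j : Fin N) (k : ℕ) :
    ringPos j k = j + Fin.ofNat N k := by
  induction k with
  | zero => ext; simp [ringPos]
  | succ k ih =>
    rw [ringPos, ih, add_assoc]
    congr 1
    ext
    simp [Fin.val_add, Nat.add_mod]

theorem ringPos_last {N : ℕ} [NeZero N] (n : Fin N) : ringPos (n + 1) (N - 1) = n := by
  have hN : 0 < N := Nat.pos_of_ne_zero (NeZero.ne N)
  have h : (1 : Fin N) + Fin.ofNat N (N - 1) = 0 := by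
    ext
    simp only [Fin.val_add, Fin.val_ofNat, Fin.val_zero, Fin.val_one', Nat.add_mod_mod,
      Nat.mod_add_mod]
    rw [show 1 + (N - 1) = N by omega, Nat.mod_self]
  rw [ringPos_eq, add_assoc, h, add_zero]

/-- Given one matrix `A j` of size `R j × R (j + 1)` at each position of the ring, the ordered
product `A j * A (j + 1) * ⋯ * A (j + k - 1)` of the `k` consecutive matrices starting at `j`. -/
def chainProd {N : ℕ} [NeZero N] {R : Fin N → ℕ}
    (A : (j : Fin N) → Matrix (Fin (R j)) (Fin (R (j + 1))) ℝ) (j : Fin N) :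
    (k : ℕ) → Matrix (Fin (R j)) (Fin (R (ringPos j k))) ℝ
  | 0 => (1 : Matrix (Fin (R j)) (Fin (R j)) ℝ)
  | k + 1 => chainProd A j k * A (ringPos j k)

/-- The multi-indices `(i_j)_{j ≠ n}`, one index for every mode except the `n`-th. They index the
`∏_{j ≠ n} I_j` rows of the least squares problem and the columns of the sketching matrix. -/
abbrev MultiIdx {N : ℕ} (I : Fin N → ℕ) (n : Fin N) : Type :=
  (j : {j : Fin N // j ≠ n}) → Fin (I j)

/-- The lateral slice at the multi-index `i` of the subchain tensor: the matrix product
`G_{n+1}(i_{n+1}) ⋯ G_N(i_N) G_1(i_1) ⋯ G_{n-1}(i_{n-1})`, of size `R_{n+1} × R_n`. Here `G j a` is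
the `a`-th lateral slice of the `j`-th core; the value `0` placed at position `n` is not one of
the `N - 1` factors. -/
def subchainSlice {N : ℕ} [NeZero N] {I R : Fin N → ℕ}
    (G : (j : Fin N) → Fin (I j) → Matrix (Fin (R j)) (Fin (R (j + 1))) ℝ)
    (n : Fin N) (i : MultiIdx I n) : Matrix (Fin (R (n + 1))) (Fin (R n)) ℝ :=
  (chainProd (fun j => if h : j ≠ n then G j (i ⟨j, h⟩) else 0) (n + 1) (N - 1)).submatrix id
    (Fin.cast (congrArg R (ringPos_last n).symm))

/-- The mode-2 unfolding of the subchain tensor: rows are multi-indices, columns are pairs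
`(r_n, r_{n+1})` of rank indices, so that there are `R_n R_{n+1}` columns. -/
def subchainUnfolding {N : ℕ} [NeZero N] {I R : Fin N → ℕ}
    (G : (j : Fin N) → Fin (I j) → Matrix (Fin (R j)) (Fin (R (j + 1))) ℝ)
    (n : Fin N) : Matrix (MultiIdx I n) (Fin (R n) × Fin (R (n + 1))) ℝ :=
  Matrix.of fun i r => subchainSlice G n i r.2 r.1

/-- The transposed mode-`n` unfolding of the tensor `X`: its entry in row `(i_j)_{j ≠ n}` and
column `i_n` is `X (i_1, …, i_N)`. -/
def unfoldingTranspose {N : ℕ} {I : Fin N → ℕ} (X : ((j : Fin N) → Fin (I j)) → ℝ)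
    (n : Fin N) : Matrix (MultiIdx I n) (Fin (I n)) ℝ :=
  Matrix.of fun i a => X ((Equiv.piSplitAt n fun j => Fin (I j)).symm (a, i))

/-- A random map `h` from the keys `κ` to the finite set `β` is a `k`-wise independent hash map:
every key has a uniformly distributed value, and the values of any at most `k` distinct keys are
independent. -/
structure IsKWiseIndepHash {Ω κ β : Type*} [MeasurableSpace Ω] [Fintype β] [MeasurableSpace β]
    (k : ℕ) (h : κ → Ω → β) (P : Measure Ω) : Prop where
  measurable : ∀ a, Measurable (h a)
  uniform : ∀ a b, P (h a ⁻¹' {b}) = (Fintype.card β : ℝ≥0∞)⁻¹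
  indep : ∀ s : Finset κ, s.card ≤ k → iIndepFun (fun a : s => h a) P

/-- The random hash maps behind a TensorSketch with `m` rows, one pair for every mode `j`: the
bucket maps `H j : [I_j] → [m]` are 3-wise independent, the sign maps `S j : [I_j] → {1, -1}` are
4-wise independent, and all these maps are drawn independently of each other. -/
structure IsTensorSketchHash {Ω J : Type*} [MeasurableSpace Ω] {I : J → ℕ} {m : ℕ}
    (H : (j : J) → Fin (I j) → Ω → Fin m) (S : (j : J) → Fin (I j) → Ω → ℤˣ)
    (P : Measure Ω) : Prop where
  bucket : ∀ j, IsKWiseIndepHash 3 (H j) P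
  sign : ∀ j, IsKWiseIndepHash 4 (S j) P
  indep_bucket : iIndepFun (fun j ω a => H j a ω) P
  indep_sign : iIndepFun (fun j ω a => S j a ω) P
  indep : IndepFun (fun ω j a => H j a ω) (fun ω j a => S j a ω) P

/-- The hashing matrix: with buckets numbered from `0`, the column of `(i_j)_j` has its only nonzero
entry, a `1`, in row `(∑ j, H_j(i_j)) mod m`. -/
noncomputable def bucketMatrix {J : Type*} [Fintype J] {I : J → ℕ} {m : ℕ}
    (H : (j : J) → Fin (I j) → Fin m) : Matrix (Fin m) ((j : J) → Fin (I j)) ℝ :=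
  Matrix.of fun k i => if (k : ℕ) = (∑ j, (H j (i j) : ℕ)) % m then 1 else 0

/-- The diagonal sign matrix, with the entry `∏ j, S_j(i_j)` at `(i_j)_j`. -/
noncomputable def signMatrix {J : Type*} [Fintype J] [DecidableEq J] {I : J → ℕ}
    (S : (j : J) → Fin (I j) → ℤˣ) : Matrix ((j : J) → Fin (I j)) ((j : J) → Fin (I j)) ℝ :=
  Matrix.diagonal fun i => (((∏ j, S j (i j) : ℤˣ) : ℤ) : ℝ)

/-- The TensorSketch matrix of the hash maps `H`, `S`: the hashing matrix times the diagonal sign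
matrix. -/
noncomputable def tensorSketch {J : Type*} [Fintype J] [DecidableEq J] {I : J → ℕ} {m : ℕ}
    (H : (j : J) → Fin (I j) → Fin m) (S : (j : J) → Fin (I j) → ℤˣ) :
    Matrix (Fin m) ((j : J) → Fin (I j)) ℝ :=
  bucketMatrix H * signMatrix S

section

attribute [local instance] Matrix.frobeniusNormedAddCommGroup

/-- The residual `‖A Z - B‖_F` in the Frobenius norm. -/
noncomputable def lsResidual {p q r : Type*} [Fintype p] [Fintype q] [Fintype r]
    (A : Matrix p q ℝ) (B : Matrix p r ℝ) (Z : Matrix q r ℝ) : ℝ :=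
  ‖A * Z - B‖

end

/-- `Z` is a solution, i.e. an argmin, of the least squares problem `min_Z ‖A Z - B‖_F`. -/
def IsLSSolution {p q r : Type*} [Fintype p] [Fintype q] [Fintype r]
    (A : Matrix p q ℝ) (B : Matrix p r ℝ) (Z : Matrix q r ℝ) : Prop :=
  ∀ W : Matrix q r ℝ, lsResidual A B Z ≤ lsResidual A B W

/-! The ring structure enters only through the number `R_n R_{n+1}` of columns and the number `N -
1` of hashed modes; the argument works for any `A` and `B` whose rows are multi-indices.

For a TensorSketch `T`, the matrix `Tᵀ T - 1` has zero diagonal, and its entry at `i ≠ j` is the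
product of the two signs if `i` and `j` collide, and zero otherwise. Expanding the square of `aᵀ (Tᵀ
T - 1) b` gives a sum over four multi-indices. The collision factor has mean at most `1 / m`, and
the mean of the signs vanishes unless the four keys pair up in every mode. In one mode the pairing
kernel costs a factor 3 by Cauchy–Schwarz, and such bounds multiply over modes (`IsQuadBound.pi`).
Hence the second moment is at most `3 ^ (N - 1) / m * ‖a‖² ‖b‖²`
(`IsTensorSketchHash.integral_sq_le`).

Let `U` be an orthonormal basis of the column space of `A` and `E` the optimal residual, so that `Uᵀ
E = 0`. Markov's inequality makes `(T U)ᵀ (T U)` close to `1` and `(T U)ᵀ (T E)` close to `0`,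
outside an event of probability at most `η`. The sketched normal equations then force
near-optimality (`lsResidual_le_of_sketch`). -/

/-! ### Quadrilinear kernels and their tensor products -/

/-- The Euclidean length `(∑ x, f x ^ 2) ^ (1 / 2)` of a real function on a finite type. -/
noncomputable def l2 {α : Type*} [Fintype α] (f : α → ℝ) : ℝ := √(∑ x, f x ^ 2)

theorem l2_nonneg {α : Type*} [Fintype α] (f : α → ℝ) : 0 ≤ l2 f := Real.sqrt_nonneg _

theorem sq_l2 {α : Type*} [Fintype α] (f : α → ℝ) : l2 f ^ 2 = ∑ x, f x ^ 2 :=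
  Real.sq_sqrt (Finset.sum_nonneg fun _ _ => sq_nonneg _)

theorem sum_mul_le_l2 {α : Type*} [Fintype α] (f g : α → ℝ) : ∑ x, f x * g x ≤ l2 f * l2 g :=
  Real.sum_mul_le_sqrt_mul_sqrt _ f g

theorem l2_prod {α β : Type*} [Fintype α] [Fintype β] (f : α × β → ℝ) :
    l2 (fun x => l2 fun y => f (x, y)) = l2 f := by
  unfold l2
  rw [Fintype.sum_prod_type]
  congr 1
  exact Finset.sum_congr rfl fun x _ => sq_l2 fun y => f (x, y)

theorem l2_comp_equiv {α β : Type*} [Fintype α] [Fintype β] (e : α ≃ β) (f : β → ℝ) :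
    l2 (fun x => f (e x)) = l2 f := by
  unfold l2
  rw [e.sum_comp fun x => f x ^ 2]

/-- A nonnegative kernel in four variables whose quadrilinear form is bounded by `c` times the
product of the Euclidean lengths, on nonnegative functions. -/
structure IsQuadBound {α : Type*} [Fintype α] (K : α → α → α → α → ℝ) (c : ℝ) : Prop where
  nonneg : ∀ x y z w, 0 ≤ K x y z w
  const_nonneg : 0 ≤ c
  le : ∀ f₁ f₂ f₃ f₄ : α → ℝ, 0 ≤ f₁ → 0 ≤ f₂ → 0 ≤ f₃ → 0 ≤ f₄ →
    ∑ x, ∑ y, ∑ z, ∑ w, K x y z w * (f₁ x * f₂ y * f₃ z * f₄ w) ≤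
      c * (l2 f₁ * l2 f₂ * l2 f₃ * l2 f₄)

theorem IsQuadBound.of_equiv {α β : Type*} [Fintype α] [Fintype β] (e : α ≃ β)
    {K : β → β → β → β → ℝ} {c : ℝ}
    (h : IsQuadBound (fun x y z w => K (e x) (e y) (e z) (e w)) c) : IsQuadBound K c where
  nonneg x y z w := by simpa using h.nonneg (e.symm x) (e.symm y) (e.symm z) (e.symm w)
  const_nonneg := h.const_nonneg
  le f₁ f₂ f₃ f₄ h₁ h₂ h₃ h₄ := by
    have := h.le (fun x => f₁ (e x)) (fun x => f₂ (e x)) (fun x => f₃ (e x)) (fun x => f₄ (e x))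
      (fun x => h₁ _) (fun x => h₂ _) (fun x => h₃ _) (fun x => h₄ _)
    simp only [l2_comp_equiv] at this
    refine le_of_eq_of_le ?_ this
    rw [← e.sum_comp]
    refine Finset.sum_congr rfl fun x _ => ?_
    rw [← e.sum_comp]
    refine Finset.sum_congr rfl fun y _ => ?_
    rw [← e.sum_comp]
    refine Finset.sum_congr rfl fun z _ => ?_
    rw [← e.sum_comp]

/-- Bound the `L`-sum on the fibres first; since `K` is nonnegative, its own bound then applies to
the fibre lengths, whose length is that of the whole function (`l2_prod`). -/
theorem IsQuadBound.prod {α β : Type*} [Fintype α] [Fintype β]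
    {K : α → α → α → α → ℝ} {L : β → β → β → β → ℝ} {c d : ℝ}
    (hK : IsQuadBound K c) (hL : IsQuadBound L d) :
    IsQuadBound (fun x y z w : α × β => K x.1 y.1 z.1 w.1 * L x.2 y.2 z.2 w.2) (c * d) where
  nonneg x y z w := mul_nonneg (hK.nonneg _ _ _ _) (hL.nonneg _ _ _ _)
  const_nonneg := mul_nonneg hK.const_nonneg hL.const_nonneg
  le f₁ f₂ f₃ f₄ h₁ h₂ h₃ h₄ := by
    have key : ∀ x y z w, K x y z w * ∑ x', ∑ y', ∑ z', ∑ w', L x' y' z' w' *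
        (f₁ (x, x') * f₂ (y, y') * f₃ (z, z') * f₄ (w, w')) ≤
        d * (K x y z w * ((l2 fun x' => f₁ (x, x')) * (l2 fun x' => f₂ (y, x')) *
          (l2 fun x' => f₃ (z, x')) * (l2 fun x' => f₄ (w, x')))) := by
      intro x y z w
      rw [mul_left_comm]
      exact mul_le_mul_of_nonneg_left (hL.le _ _ _ _ (fun x => h₁ _) (fun x => h₂ _)
        (fun x => h₃ _) (fun x => h₄ _)) (hK.nonneg _ _ _ _)
    calc _ = ∑ x, ∑ y, ∑ z, ∑ w, K x y z w * ∑ x', ∑ y', ∑ z', ∑ w', L x' y' z' w' *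
        (f₁ (x, x') * f₂ (y, y') * f₃ (z, z') * f₄ (w, w')) := by
          have sw (F : β → α → ℝ) : ∑ x', ∑ y, F x' y = ∑ y, ∑ x', F x' y := Finset.sum_comm
          simp only [Fintype.sum_prod_type, Finset.mul_sum, sw, mul_assoc]
      _ ≤ ∑ x, ∑ y, ∑ z, ∑ w, d * (K x y z w * ((l2 fun x' => f₁ (x, x')) *
          (l2 fun x' => f₂ (y, x')) * (l2 fun x' => f₃ (z, x')) * (l2 fun x' => f₄ (w, x')))) :=
        Finset.sum_le_sum fun x _ => Finset.sum_le_sum fun y _ => Finset.sum_le_sum fun z _ =>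
          Finset.sum_le_sum fun w _ => key x y z w
      _ ≤ d * (c * (l2 f₁ * l2 f₂ * l2 f₃ * l2 f₄)) := by
        simp only [← Finset.mul_sum]
        refine mul_le_mul_of_nonneg_left ?_ hL.const_nonneg
        have := hK.le (fun x => l2 fun x' => f₁ (x, x')) (fun x => l2 fun x' => f₂ (x, x'))
          (fun x => l2 fun x' => f₃ (x, x')) (fun x => l2 fun x' => f₄ (x, x'))
          (fun x => l2_nonneg _) (fun x => l2_nonneg _) (fun x => l2_nonneg _)
          (fun x => l2_nonneg _)
        simpa only [l2_prod] using this
      _ = _ := by ring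

theorem IsQuadBound.pi {J : Type*} [Fintype J] {c : ℝ} :
    ∀ (β : J → Type) [∀ j, Fintype (β j)] [DecidableEq J] (K : ∀ j, β j → β j → β j → β j → ℝ),
      (∀ j, IsQuadBound (K j) c) →
      IsQuadBound (fun x y z w : (j : J) → β j => ∏ j, K j (x j) (y j) (z j) (w j))
        (c ^ Fintype.card J) := by
  refine Fintype.induction_empty_option (P := fun J _ => ∀ (β : J → Type) [∀ j, Fintype (β j)]
      [DecidableEq J] (K : ∀ j, β j → β j → β j → β j → ℝ), (∀ j, IsQuadBound (K j) c) →
      IsQuadBound (fun x y z w : (j : J) → β j => ∏ j, K j (x j) (y j) (z j) (w j))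
        (c ^ Fintype.card J)) ?_ ?_ ?_ J
  · intro J J' _ e ih β _ _ K hK
    let _ := Fintype.ofEquiv J' e.symm
    classical
    refine IsQuadBound.of_equiv (e.piCongrLeft β) ?_
    have := ih (fun j => β (e j)) (fun j => K (e j)) fun j => hK _
    rw [Fintype.card_congr e] at this
    convert this using 6 with x y z w
    rw [← e.prod_comp]
    simp only [Equiv.piCongrLeft_apply_apply]
  · intro β _ _ K hK
    refine ⟨by simp, by simp, fun f₁ f₂ f₃ f₄ h₁ h₂ h₃ h₄ => ?_⟩
    have e (f : ((j : PEmpty) → β j) → ℝ) (hf : 0 ≤ f) : l2 f = f default := by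
      simp [l2, Real.sqrt_sq (hf _)]
    simp [e, h₁, h₂, h₃, h₄]
  · intro J _ ih β _ _ K hK
    classical
    refine IsQuadBound.of_equiv Equiv.piOptionEquivProd.symm ?_
    have := (hK none).prod (ih (fun j => β (some j)) (fun j => K (some j)) fun j => hK _)
    rw [Fintype.card_option, pow_succ']
    simpa [Fintype.prod_option] using this

/-- Four keys that can be split into two pairs of equal keys. -/
def Paired {α : Type*} (x y z w : α) : Prop :=
  (x = y ∧ z = w) ∨ (x = z ∧ y = w) ∨ (x = w ∧ y = z)

-- The indicator is at most the sum of the indicators of the three pairings (overcounting when all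
-- keys agree). For each pairing the form factors into two inner products, and Cauchy–Schwarz bounds
-- both.
open scoped Classical in
theorem isQuadBound_paired (α : Type*) [Fintype α] :
    IsQuadBound (fun x y z w : α => if Paired x y z w then (1 : ℝ) else 0) 3 where
  nonneg x y z w := by split_ifs <;> norm_num
  const_nonneg := by norm_num
  le f₁ f₂ f₃ f₄ h₁ h₂ h₃ h₄ := by
    have hp : ∀ x y z w, (if Paired x y z w then (1 : ℝ) else 0) * (f₁ x * f₂ y * f₃ z * f₄ w) ≤
        (if x = y then if z = w then f₁ x * f₂ y * f₃ z * f₄ w else 0 else 0) +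
        (if x = z then if y = w then f₁ x * f₂ y * f₃ z * f₄ w else 0 else 0) +
        (if x = w then if y = z then f₁ x * f₂ y * f₃ z * f₄ w else 0 else 0) := by
      intro x y z w
      have h : 0 ≤ f₁ x * f₂ y * f₃ z * f₄ w :=
        mul_nonneg (mul_nonneg (mul_nonneg (h₁ _) (h₂ _)) (h₃ _)) (h₄ _)
      by_cases hp : Paired x y z w
      · rw [if_pos hp, one_mul]
        rcases hp with ⟨rfl, rfl⟩ | ⟨rfl, rfl⟩ | ⟨rfl, rfl⟩ <;> simp only [if_true] <;>
          split_ifs <;> linarith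
      · rw [if_neg hp, zero_mul]
        split_ifs <;> linarith
    refine (Finset.sum_le_sum fun x _ => Finset.sum_le_sum fun y _ => Finset.sum_le_sum fun z _ =>
      Finset.sum_le_sum fun w _ => hp x y z w).trans ?_
    have e₁ : ∑ x, ∑ y, ∑ z, ∑ w,
        (if x = y then if z = w then f₁ x * f₂ y * f₃ z * f₄ w else 0 else 0) =
        (∑ x, f₁ x * f₂ x) * ∑ x, f₃ x * f₄ x := by
      rw [Finset.sum_mul_sum]
      refine Finset.sum_congr rfl fun x _ => ?_
      rw [Finset.sum_comm]
      refine Finset.sum_congr rfl fun z _ => ?_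
      rw [Finset.sum_comm]
      simp [mul_assoc]
    have e₂ : ∑ x, ∑ y, ∑ z, ∑ w,
        (if x = z then if y = w then f₁ x * f₂ y * f₃ z * f₄ w else 0 else 0) =
        (∑ x, f₁ x * f₃ x) * ∑ x, f₂ x * f₄ x := by
      rw [Finset.sum_mul_sum]
      refine Finset.sum_congr rfl fun x _ => Finset.sum_congr rfl fun y _ => ?_
      rw [Finset.sum_comm]
      simp [mul_assoc, mul_left_comm]
    have e₃ : ∑ x, ∑ y, ∑ z, ∑ w,
        (if x = w then if y = z then f₁ x * f₂ y * f₃ z * f₄ w else 0 else 0) =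
        (∑ x, f₁ x * f₄ x) * ∑ x, f₂ x * f₃ x := by
      rw [Finset.sum_mul_sum]
      refine Finset.sum_congr rfl fun x _ => Finset.sum_congr rfl fun y _ => ?_
      simp
      ring
    simp only [Finset.sum_add_distrib]
    rw [e₁, e₂, e₃]
    have b (f₁ f₂ f₃ f₄ : α → ℝ) (h₃ : 0 ≤ f₃) (h₄ : 0 ≤ f₄) :
        (∑ x, f₁ x * f₂ x) * ∑ x, f₃ x * f₄ x ≤ (l2 f₁ * l2 f₂) * (l2 f₃ * l2 f₄) :=
      mul_le_mul (sum_mul_le_l2 _ _) (sum_mul_le_l2 _ _)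
        (Finset.sum_nonneg fun x _ => mul_nonneg (h₃ x) (h₄ x))
        (mul_nonneg (l2_nonneg _) (l2_nonneg _))
    linarith [b f₁ f₂ f₃ f₄ h₃ h₄, b f₁ f₃ f₂ f₄ h₂ h₄, b f₁ f₄ f₂ f₃ h₂ h₃]

/-! ### Frobenius norm, least squares and the deterministic sketching bound -/

section

attribute [local instance] Matrix.frobeniusNormedAddCommGroup Matrix.frobeniusNormedSpace

open Matrix

theorem frobenius_norm_sq {p q : Type*} [Fintype p] [Fintype q] (M : Matrix p q ℝ) :
    ‖M‖ ^ 2 = ∑ i, ∑ j, M i j ^ 2 := by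
  have h : 0 ≤ ∑ i, ∑ j, ‖M i j‖ ^ 2 := by positivity
  rw [frobenius_norm_def, ← Real.sqrt_eq_rpow]
  simp only [Real.rpow_ofNat]
  rw [Real.sq_sqrt h]
  simp

theorem frobenius_norm_sq_eq_trace {p q : Type*} [Fintype p] [Fintype q] (M : Matrix p q ℝ) :
    ‖M‖ ^ 2 = (Mᵀ * M).trace := by
  rw [frobenius_norm_sq, Finset.sum_comm]
  simp [trace, mul_apply, pow_two]

theorem frobenius_norm_add_sq_of_orthogonal {p q : Type*} [Fintype p] [Fintype q]
    (M N : Matrix p q ℝ) (h : Mᵀ * N = 0) : ‖M + N‖ ^ 2 = ‖M‖ ^ 2 + ‖N‖ ^ 2 := by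
  have h' : Nᵀ * M = 0 := by simpa using congrArg transpose h
  simp only [frobenius_norm_sq_eq_trace, transpose_add, Matrix.add_mul, Matrix.mul_add, h, h',
    trace_add, add_zero, zero_add]

variable {p q r : Type*} [Fintype p] [Fintype q] [Fintype r]

theorem frobenius_norm_mul_of_orthonormal [DecidableEq q] (U : Matrix p q ℝ) (hU : Uᵀ * U = 1)
    (Y : Matrix q r ℝ) : ‖U * Y‖ = ‖Y‖ := by
  rw [← sq_eq_sq₀ (norm_nonneg _) (norm_nonneg _), frobenius_norm_sq_eq_trace,
    frobenius_norm_sq_eq_trace, transpose_mul, Matrix.mul_assoc, ← Matrix.mul_assoc Uᵀ, hU,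
    Matrix.one_mul]

/-- Pythagoras: the normal equations make the residual orthogonal to the column space of `A`. -/
theorem lsResidual_sq_of_normal {A : Matrix p q ℝ} {B : Matrix p r ℝ} {Z : Matrix q r ℝ}
    (h : Aᵀ * (A * Z - B) = 0) (W : Matrix q r ℝ) :
    lsResidual A B W ^ 2 = ‖A * (W - Z)‖ ^ 2 + lsResidual A B Z ^ 2 := by
  unfold lsResidual
  rw [← frobenius_norm_add_sq_of_orthogonal]
  · congr 2
    rw [Matrix.mul_sub]; abel
  · rw [transpose_mul, Matrix.mul_assoc, h, Matrix.mul_zero]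

theorem lsResidual_nonneg (A : Matrix p q ℝ) (B : Matrix p r ℝ) (Z : Matrix q r ℝ) :
    0 ≤ lsResidual A B Z := norm_nonneg _

theorem isLSSolution_of_normal {A : Matrix p q ℝ} {B : Matrix p r ℝ} {Z : Matrix q r ℝ}
    (h : Aᵀ * (A * Z - B) = 0) : IsLSSolution A B Z := fun W => by
  rw [← sq_le_sq₀ (lsResidual_nonneg _ _ _) (lsResidual_nonneg _ _ _),
    lsResidual_sq_of_normal h W]
  exact le_add_of_nonneg_left (sq_nonneg _)

/-- `Aᵀ A` and `Aᵀ` have the same rank, hence the same range, so the normal equations are solvable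
column by column, whatever the rank of `A`. -/
theorem exists_normal {r : Type*} (A : Matrix p q ℝ) (B : Matrix p r ℝ) :
    ∃ Z : Matrix q r ℝ, Aᵀ * (A * Z - B) = 0 := by
  classical
  have hr : LinearMap.range (Aᵀ * A).mulVecLin = LinearMap.range Aᵀ.mulVecLin := by
    refine Submodule.eq_of_le_of_finrank_eq ?_ ?_
    · rw [mulVecLin_mul]
      exact LinearMap.range_comp_le_range _ _
    · exact (rank_transpose_mul_self A).trans (rank_transpose A).symm
  have hz : ∀ c : r, ∃ z : q → ℝ, (Aᵀ * A) *ᵥ z = Aᵀ *ᵥ (B.col c) := fun c => by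
    have : Aᵀ *ᵥ (B.col c) ∈ LinearMap.range (Aᵀ * A).mulVecLin := by
      rw [hr]; exact ⟨_, rfl⟩
    exact this
  choose z hz using hz
  refine ⟨(Matrix.of z)ᵀ, ?_⟩
  rw [Matrix.mul_sub, ← Matrix.mul_assoc, sub_eq_zero]
  ext i c
  exact congrFun (hz c) i

theorem IsLSSolution.normal {A : Matrix p q ℝ} {B : Matrix p r ℝ} {Z : Matrix q r ℝ}
    (h : IsLSSolution A B Z) : Aᵀ * (A * Z - B) = 0 := by
  obtain ⟨W, hW⟩ := exists_normal A B
  have h₁ := (sq_le_sq₀ (lsResidual_nonneg _ _ _) (lsResidual_nonneg _ _ _)).2 (h W)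
  rw [lsResidual_sq_of_normal hW Z] at h₁
  have h₂ : A * (Z - W) = 0 := by
    rw [← norm_eq_zero, ← sq_eq_zero_iff]
    exact le_antisymm (by linarith) (sq_nonneg _)
  have h₃ : A * Z = A * W := by rwa [Matrix.mul_sub, sub_eq_zero] at h₂
  rw [h₃, hW]

/-- A QR-type factorization from an orthonormal basis of the column space; `d` is the rank of `A`,
so full column rank is not needed. The matrix `W` serves to turn normal equations for `T A` into
equations for `T U`. -/
theorem exists_orthonormal_factor (A : Matrix p q ℝ) :
    ∃ (d : ℕ) (U : Matrix p (Fin d) ℝ) (M : Matrix (Fin d) q ℝ) (W : Matrix q (Fin d) ℝ),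
      d ≤ Fintype.card q ∧ Uᵀ * U = 1 ∧ A = U * M ∧ U = A * W := by
  classical
  let L : (q → ℝ) →ₗ[ℝ] EuclideanSpace ℝ p :=
    (WithLp.linearEquiv 2 ℝ (p → ℝ)).symm.toLinearMap ∘ₗ A.mulVecLin
  have hL (v : q → ℝ) (i : p) : (L v) i = (A *ᵥ v) i := rfl
  clear_value L
  have hd : Module.finrank ℝ (LinearMap.range L) ≤ Fintype.card q := by
    simpa using LinearMap.finrank_range_le L
  obtain ⟨b⟩ : Nonempty (OrthonormalBasis (Fin (Module.finrank ℝ (LinearMap.range L))) ℝ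
    (LinearMap.range L)) := ⟨stdOrthonormalBasis ℝ _⟩
  have hw : ∀ k, ∃ w : q → ℝ, L w = b k := fun k => (b k).2
  choose w hw using hw
  refine ⟨_, Matrix.of fun i k => (b k : EuclideanSpace ℝ p) i,
    Matrix.of fun k j => b.repr ⟨L (Pi.single j 1), ⟨_, rfl⟩⟩ k, Matrix.of fun j k => w k j,
    hd, ?_, ?_, ?_⟩
  · ext k l
    have := orthonormal_iff_ite.1 b.orthonormal k l
    rw [Submodule.coe_inner, PiLp.inner_apply] at this
    simp only [mul_apply, transpose_apply, of_apply, one_apply]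
    rw [← this]
    refine Finset.sum_congr rfl fun i _ => ?_
    rw [RCLike.inner_apply, conj_trivial, mul_comm]
  · ext i j
    have h := b.sum_repr ⟨L (Pi.single j 1), ⟨_, rfl⟩⟩
    have h' := congrArg (fun v : LinearMap.range L => (v : EuclideanSpace ℝ p) i) h
    simp only [Submodule.coe_sum, Submodule.coe_smul, WithLp.ofLp_sum, Finset.sum_apply,
      PiLp.smul_apply, smul_eq_mul, hL, mulVec_single_one] at h'
    rw [mul_apply]
    simp only [of_apply]
    rw [← col_apply A, ← h']
    exact Finset.sum_congr rfl fun k _ => mul_comm _ _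
  · ext i k
    have := congrArg (fun v : EuclideanSpace ℝ p => v i) (hw k)
    exact this.symm.trans (hL _ _)

/-- A sketch `T` that nearly preserves an orthonormal basis `U` of the column space of `A`, and
nearly preserves its orthogonality to the optimal residual, has only near-optimal solutions. -/
theorem lsResidual_le_of_sketch {s : Type*} [Fintype s] {d : ℕ} {A : Matrix p q ℝ}
    {B : Matrix p r ℝ} {U : Matrix p (Fin d) ℝ} {M : Matrix (Fin d) q ℝ} {W : Matrix q (Fin d) ℝ}
    (hU : Uᵀ * U = 1) (hM : A = U * M) (hW : U = A * W) {Z₀ Z : Matrix q r ℝ}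
    (T : Matrix s p ℝ) {ε : ℝ}
    (hT : ‖(T * U)ᵀ * (T * U) - Uᵀ * U‖ ≤ 1 / 2)
    (hE : ‖(T * U)ᵀ * (T * (A * Z₀ - B))‖ ≤ ε * lsResidual A B Z₀)
    (hZ : IsLSSolution (T * A) (T * B) Z) :
    lsResidual A B Z ≤ (1 + 2 * ε) * lsResidual A B Z₀ := by
  set Y := M * (Z - Z₀) with hY
  have hUY : U * Y = A * Z - A * Z₀ := by
    rw [hY, ← Matrix.mul_assoc, ← hM, Matrix.mul_sub]
  -- The sketched normal equations, multiplied by `Wᵀ` on the left.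
  have hn : (T * U)ᵀ * (T * (U * Y)) + (T * U)ᵀ * (T * (A * Z₀ - B)) = 0 := by
    have h := congrArg (Wᵀ * ·) hZ.normal
    simp only [Matrix.mul_zero] at h
    rw [← Matrix.mul_assoc, ← transpose_mul, Matrix.mul_assoc T, ← hW] at h
    rw [← Matrix.mul_add, ← Matrix.mul_add, hUY, sub_add_sub_cancel, Matrix.mul_sub T,
      ← Matrix.mul_assoc T]
    exact h
  have hYe : Y = -(((T * U)ᵀ * (T * U) - Uᵀ * U) * Y + (T * U)ᵀ * (T * (A * Z₀ - B))) := by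
    rw [hU, Matrix.sub_mul, Matrix.one_mul, Matrix.mul_assoc, Matrix.mul_assoc T, sub_add_eq_add_sub,
      hn]
    simp
  -- Absorbing the half gives `‖Y‖ ≤ 2 ε · opt`, the origin of `K = 2`.
  have h₁ : ‖Y‖ ≤ 1 / 2 * ‖Y‖ + ε * lsResidual A B Z₀ := by
    calc ‖Y‖ = ‖((T * U)ᵀ * (T * U) - Uᵀ * U) * Y + (T * U)ᵀ * (T * (A * Z₀ - B))‖ := by
          conv_lhs => rw [hYe, norm_neg]
      _ ≤ ‖((T * U)ᵀ * (T * U) - Uᵀ * U) * Y‖ + ‖(T * U)ᵀ * (T * (A * Z₀ - B))‖ := norm_add_le _ _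
      _ ≤ _ := by
        gcongr
        exact (frobenius_norm_mul _ _).trans (by gcongr)
  have h₂ : lsResidual A B Z ≤ ‖Y‖ + lsResidual A B Z₀ := by
    rw [← frobenius_norm_mul_of_orthonormal U hU Y, hUY]
    unfold lsResidual
    refine le_of_eq_of_le ?_ (norm_add_le _ _)
    rw [sub_add_sub_cancel]
  linarith

end

/-! ### Finitely valued random variables and independence -/

instance Units.instMeasurableSingletonClass {M : Type*} [Monoid M] [MeasurableSpace M]
    [MeasurableSingletonClass M] : MeasurableSingletonClass Mˣ where
  measurableSet_singleton u :=
    ⟨{(u : M)}, measurableSet_singleton _, by ext v; simp [Units.ext_iff]⟩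

section Independence

variable {Ω : Type*} [MeasurableSpace Ω] {P : Measure Ω} [IsProbabilityMeasure P]

/-- An integral of a function of a finitely valued random variable always exists. -/
theorem integrable_comp_of_finite {α : Type*} [Finite α] [MeasurableSpace α]
    [MeasurableSingletonClass α] {X : Ω → α} (hX : Measurable X) (f : α → ℝ) :
    Integrable (fun ω => f (X ω)) P :=
  have := Measure.isProbabilityMeasure_map (μ := P) hX.aemeasurable
  (Integrable.of_finite (μ := P.map X)).comp_measurable hX

/-- Condition on the value `c` of `Y`: the independent uniform `X` hits `g c` with the same
probability for every `c`. -/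
theorem measure_eq_comp_of_uniform {β γ : Type*} [Fintype β] [MeasurableSpace β]
    [MeasurableSingletonClass β] [Fintype γ] [MeasurableSpace γ] [MeasurableSingletonClass γ]
    {X : Ω → β} {Y : Ω → γ} (hX : Measurable X) (hY : Measurable Y) (hXY : IndepFun X Y P)
    (hu : ∀ b, P (X ⁻¹' {b}) = (Fintype.card β : ℝ≥0∞)⁻¹) (g : γ → β) :
    P {ω | X ω = g (Y ω)} = (Fintype.card β : ℝ≥0∞)⁻¹ := by
  have h₁ : {ω | X ω = g (Y ω)} = ⋃ c ∈ (Finset.univ : Finset γ), X ⁻¹' {g c} ∩ Y ⁻¹' {c} := by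
    ext ω; simp
  rw [h₁, measure_biUnion_finset]
  · have h₂ : ∀ c, P (X ⁻¹' {g c} ∩ Y ⁻¹' {c}) = (Fintype.card β : ℝ≥0∞)⁻¹ * P (Y ⁻¹' {c}) :=
      fun c => by
        rw [hXY.measure_inter_preimage_eq_mul _ _ (measurableSet_singleton _)
          (measurableSet_singleton _), hu]
    simp_rw [h₂]
    rw [← Finset.mul_sum, sum_measure_preimage_singleton _
      fun c _ => hY (measurableSet_singleton c)]
    simp
  · intro c _ d _ hcd
    refine Set.disjoint_left.2 fun ω hω hω' => hcd ?_
    exact hω.2.symm.trans hω'.2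
  · exact fun c _ => (hX (measurableSet_singleton _)).inter (hY (measurableSet_singleton _))

theorem indepFun_prod_of_indepFun {α β γ : Type*} [MeasurableSpace α] [MeasurableSpace β]
    [MeasurableSpace γ] {X : Ω → α} {X' : Ω → β} {Y : Ω → γ} (hX : Measurable X)
    (hX' : Measurable X') (hY : Measurable Y) (h : IndepFun X X' P)
    (hXY : IndepFun (fun ω => (X ω, X' ω)) Y P) : IndepFun X (fun ω => (X' ω, Y ω)) P := by
  have := Measure.isProbabilityMeasure_map (μ := P) hX.aemeasurable
  have := Measure.isProbabilityMeasure_map (μ := P) hX'.aemeasurable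
  have := Measure.isProbabilityMeasure_map (μ := P) hY.aemeasurable
  have h' : IndepFun X' Y P := hXY.comp measurable_snd measurable_id
  rw [indepFun_iff_map_prod_eq_prod_map_map (by fun_prop) (by fun_prop)] at h hXY h' ⊢
  rw [h', ← Measure.prodAssoc_prod, ← h, ← hXY,
    Measure.map_map (MeasurableEquiv.measurable _) (by fun_prop)]
  rfl

end Independence

/-! ### Sign moments and collision probabilities -/

section Hashing

variable {Ω : Type*} [MeasurableSpace Ω] {P : Measure Ω} [IsProbabilityMeasure P]

omit [IsProbabilityMeasure P] in
theorem IsKWiseIndepHash.indepFun {κ β : Type*} [Fintype β] [MeasurableSpace β] {k : ℕ}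
    {h : κ → Ω → β} (hh : IsKWiseIndepHash k h P) (hk : 2 ≤ k) {a b : κ} (hab : a ≠ b) :
    IndepFun (h a) (h b) P := by
  classical
  have := hh.indep {a, b} (Finset.card_le_two.trans hk)
  exact this.indepFun (i := ⟨a, by simp⟩) (j := ⟨b, by simp⟩) (by simpa using hab)

theorem integral_sign {κ : Type*} {k : ℕ} {S : κ → Ω → ℤˣ} (hS : IsKWiseIndepHash k S P) (a : κ) :
    ∫ ω, ((S a ω : ℤ) : ℝ) ∂P = 0 := by
  have := Measure.isProbabilityMeasure_map (μ := P) (hS.measurable a).aemeasurable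
  have h := integral_map (μ := P) (φ := S a) (f := fun u : ℤˣ => ((u : ℤ) : ℝ))
    (hS.measurable a).aemeasurable Measurable.of_discrete.aestronglyMeasurable
  rw [← h, integral_fintype Integrable.of_finite]
  have hu (u : ℤˣ) : (P.map (S a)).real {u} = 2⁻¹ := by
    rw [Measure.real, Measure.map_apply (hS.measurable a) (measurableSet_singleton _), hS.uniform]
    simp
  simp [hu, UnitsInt.univ]

/-- The sign at the isolated key `x` has mean zero and is independent of the other three, which may
coincide among themselves. -/
theorem integral_sign_mul_of_ne {κ : Type*} {S : κ → Ω → ℤˣ} (hS : IsKWiseIndepHash 4 S P)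
    {x y z w : κ} (hy : x ≠ y) (hz : x ≠ z) (hw : x ≠ w) :
    ∫ ω, ((S x ω : ℤ) : ℝ) * (((S y ω : ℤ) : ℝ) * ((S z ω : ℤ) : ℝ) * ((S w ω : ℤ) : ℝ)) ∂P = 0 := by
  classical
  let s : Finset κ := {x, y, z, w}
  have hi := hS.indep s Finset.card_le_four
  let x' : s := ⟨x, by simp [s]⟩
  let y' : s := ⟨y, by simp [s]⟩
  let z' : s := ⟨z, by simp [s]⟩
  let w' : s := ⟨w, by simp [s]⟩
  have hd : Disjoint ({x'} : Finset s) {y', z', w'} := by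
    simp [x', y', z', w', hy, hz, hw]
  have h := hi.indepFun_finset {x'} {y', z', w'} hd fun i => hS.measurable i
  have h' := h.comp (φ := fun u => ((u ⟨x', by simp⟩ : ℤ) : ℝ))
    (ψ := fun u => ((u ⟨y', by simp⟩ : ℤ) : ℝ) * ((u ⟨z', by simp⟩ : ℤ) : ℝ) *
      ((u ⟨w', by simp⟩ : ℤ) : ℝ)) Measurable.of_discrete Measurable.of_discrete
  have hm (a : κ) : Measurable fun ω => ((S a ω : ℤ) : ℝ) :=
    (Measurable.of_discrete (f := fun u : ℤˣ => ((u : ℤ) : ℝ))).comp (hS.measurable a)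
  have := h'.integral_fun_mul_eq_mul_integral (hm x).aestronglyMeasurable
    (((hm y).mul (hm z)).mul (hm w)).aestronglyMeasurable
  refine this.trans ?_
  have h0 := integral_sign hS x
  simp only [Function.comp_def]
  exact mul_eq_zero_of_left h0 _

open scoped Classical in
theorem abs_integral_sign_le {κ : Type*} {S : κ → Ω → ℤˣ} (hS : IsKWiseIndepHash 4 S P)
    (x y z w : κ) :
    |∫ ω, ((S x ω : ℤ) : ℝ) * ((S y ω : ℤ) : ℝ) * ((S z ω : ℤ) : ℝ) * ((S w ω : ℤ) : ℝ) ∂P| ≤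
      if Paired x y z w then 1 else 0 := by
  split_ifs with hp
  · have h1 (u : ℤˣ) : |((u : ℤ) : ℝ)| = 1 := by
      rcases Int.units_eq_one_or u with rfl | rfl <;> simp
    have := norm_integral_le_of_norm_le_const (μ := P) (C := 1)
      (f := fun ω => ((S x ω : ℤ) : ℝ) * ((S y ω : ℤ) : ℝ) * ((S z ω : ℤ) : ℝ) * ((S w ω : ℤ) : ℝ))
      (Filter.Eventually.of_forall fun ω => by simp [h1])
    simpa using this
  -- Four keys that do not pair up include one that differs from the other three.
  · have hc : (x ≠ y ∧ x ≠ z ∧ x ≠ w) ∨ (y ≠ x ∧ y ≠ z ∧ y ≠ w) ∨ (z ≠ x ∧ z ≠ y ∧ z ≠ w) ∨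
        (w ≠ x ∧ w ≠ y ∧ w ≠ z) := by
      unfold Paired at hp
      grind
    refine le_of_eq (abs_eq_zero.2 ?_)
    rcases hc with ⟨h₁, h₂, h₃⟩ | ⟨h₁, h₂, h₃⟩ | ⟨h₁, h₂, h₃⟩ | ⟨h₁, h₂, h₃⟩ <;>
      rw [← integral_sign_mul_of_ne hS h₁ h₂ h₃] <;>
      exact integral_congr_ae (Filter.Eventually.of_forall fun ω => by ring)

variable {J : Type} [Fintype J] {I : J → ℕ} {m : ℕ}

/-- The bucket of a multi-index under the combined hash map of a TensorSketch. -/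
def combinedHash (H : (j : J) → Fin (I j) → Fin m) (i : (j : J) → Fin (I j)) : ℕ :=
  (∑ j, (H j (i j) : ℕ)) % m

/-- The sign of a multi-index under the combined sign map of a TensorSketch. -/
def combinedSign (S : (j : J) → Fin (I j) → ℤˣ) (i : (j : J) → Fin (I j)) : ℝ :=
  ((∏ j, S j (i j) : ℤˣ) : ℤ)

/-- Choose a mode `t` where the multi-indices differ. Once `H t (i' t)` and the hashes of all other
modes are known, a collision determines `H t (i t)`, which is uniform and independent of them. -/
theorem measure_combinedHash_eq_le [NeZero m] {H : (j : J) → Fin (I j) → Ω → Fin m}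
    (hH : ∀ j, IsKWiseIndepHash 3 (H j) P) (hi : iIndepFun (fun j ω a => H j a ω) P)
    {i i' : (j : J) → Fin (I j)} (hii : i ≠ i') :
    P.real {ω | combinedHash (fun j a => H j a ω) i = combinedHash (fun j a => H j a ω) i'} ≤
      (m : ℝ)⁻¹ := by
  classical
  obtain ⟨t, ht⟩ := Function.ne_iff.1 hii
  have hm (j : J) : Measurable fun ω a => H j a ω :=
    measurable_pi_lambda _ fun a => (hH j).measurable a
  let E : Finset J := Finset.univ.erase t
  have h := hi.indepFun_finset {t} E (by simp [E]) hm
  let Y : Ω → (j : E) → Fin (I j) → Fin m := fun ω j a => H j a ω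
  have hY : Measurable Y := measurable_pi_lambda _ fun j => hm j
  have h₁ : IndepFun (fun ω => (H t (i t) ω, H t (i' t) ω)) Y P :=
    h.comp (φ := fun u => (u ⟨t, by simp⟩ (i t), u ⟨t, by simp⟩ (i' t))) (ψ := id)
      Measurable.of_discrete measurable_id
  have h₂ := indepFun_prod_of_indepFun ((hH t).measurable _) ((hH t).measurable _) hY
    ((hH t).indepFun (by norm_num) ht) h₁
  -- The collision congruence solved for `H t (i t)`; in `ℕ`, multiplication by `m - 1` stands for
  -- negation modulo `m`.
  let g : Fin m × ((j : E) → Fin (I j) → Fin m) → Fin m := fun u =>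
    Fin.ofNat m (u.1 + ∑ j : E, (u.2 j (i' j) : ℕ) + (m - 1) * ∑ j : E, (u.2 j (i j) : ℕ))
  have h₃ := measure_eq_comp_of_uniform ((hH t).measurable (i t))
    (((hH t).measurable (i' t)).prodMk hY) h₂ ((hH t).uniform _) g
  have hsub : {ω | combinedHash (fun j a => H j a ω) i = combinedHash (fun j a => H j a ω) i'} ⊆
      {ω | H t (i t) ω = g (H t (i' t) ω, Y ω)} := by
    intro ω hω
    have hs (k : (j : J) → Fin (I j)) : ∑ j, (H j (k j) ω : ℕ) =
        H t (k t) ω + ∑ j : E, (H j (k j) ω : ℕ) := by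
      rw [Finset.sum_coe_sort E fun j => (H j (k j) ω : ℕ)]
      exact (Finset.add_sum_erase _ (fun j => (H j (k j) ω : ℕ)) (Finset.mem_univ t)).symm
    simp only [Set.mem_ofPred_eq, combinedHash, hs] at hω
    have h₄ := Nat.ModEq.add_right ((m - 1) * ∑ j : E, (H j (i j) ω : ℕ)) hω
    have hm1 : ∀ A, A + (m - 1) * A = m * A := fun A => by
      obtain ⟨k, hk⟩ := Nat.exists_eq_succ_of_ne_zero (NeZero.ne m)
      rw [hk, Nat.succ_sub_one, Nat.succ_mul, add_comm]
    rw [add_assoc, hm1] at h₄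
    ext
    simp only [g, Y, Fin.val_ofNat]
    rw [← h₄, Nat.add_mul_mod_self_left, Nat.mod_eq_of_lt (Fin.is_lt _)]
  calc _ ≤ P.real {ω | H t (i t) ω = g (H t (i' t) ω, Y ω)} := measureReal_mono hsub
    _ = (m : ℝ)⁻¹ := by rw [Measure.real, h₃]; simp

end Hashing

/-! ### Second moment of the error in sketched inner products -/

theorem IsTensorSketchHash.measurable_bucket {J : Type} {I : J → ℕ} {m : ℕ} {Ω : Type*} [MeasurableSpace Ω]
    {P : Measure Ω} {H : (j : J) → Fin (I j) → Ω → Fin m} {S : (j : J) → Fin (I j) → Ω → ℤˣ}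
    (h : IsTensorSketchHash H S P) :
    Measurable fun ω j a => H j a ω :=
  measurable_pi_lambda _ fun j => measurable_pi_lambda _ fun a => (h.bucket j).measurable a

theorem IsTensorSketchHash.measurable_sign {J : Type} {I : J → ℕ} {m : ℕ} {Ω : Type*} [MeasurableSpace Ω]
    {P : Measure Ω} {H : (j : J) → Fin (I j) → Ω → Fin m} {S : (j : J) → Fin (I j) → Ω → ℤˣ}
    (h : IsTensorSketchHash H S P) :
    Measurable fun ω j a => S j a ω :=
  measurable_pi_lambda _ fun j => measurable_pi_lambda _ fun a => (h.sign j).measurable a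

section SecondMoment

variable {J : Type} [Fintype J] {I : J → ℕ} {m : ℕ} {Ω : Type*} [MeasurableSpace Ω]
  {P : Measure Ω} [IsProbabilityMeasure P]

theorem combinedSign_mul_self (S : (j : J) → Fin (I j) → ℤˣ) (i : (j : J) → Fin (I j)) :
    combinedSign S i * combinedSign S i = 1 := by
  unfold combinedSign
  rw [← Int.cast_mul, ← Units.val_mul, Int.units_mul_self]
  simp

theorem abs_integral_combinedSign_le {S : (j : J) → Fin (I j) → Ω → ℤˣ}
    (hS : ∀ j, IsKWiseIndepHash 4 (S j) P) (hi : iIndepFun (fun j ω a => S j a ω) P)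
    {σ : Ω → ((j : J) → Fin (I j)) → ℝ} (hσ : ∀ ω, σ ω = combinedSign fun j a => S j a ω)
    (x y z w : (j : J) → Fin (I j)) :
    |∫ ω, σ ω x * σ ω y * σ ω z * σ ω w ∂P| ≤
      ∏ j, open scoped Classical in if Paired (x j) (y j) (z j) (w j) then 1 else 0 := by
  have hm (j : J) : Measurable fun ω a => S j a ω :=
    measurable_pi_lambda _ fun a => (hS j).measurable a
  have h := hi.integral_fun_prod_comp (f := fun j u => (((u (x j) : ℤˣ) : ℤ) : ℝ) *
    (((u (y j) : ℤˣ) : ℤ) : ℝ) * (((u (z j) : ℤˣ) : ℤ) : ℝ) * (((u (w j) : ℤˣ) : ℤ) : ℝ))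
    (fun j => (hm j).aemeasurable) fun j => Measurable.of_discrete.aestronglyMeasurable
  simp only [Finset.prod_mul_distrib] at h
  have e (ω : Ω) (x : (j : J) → Fin (I j)) : σ ω x = ∏ j, (((S j (x j) ω : ℤˣ) : ℤ) : ℝ) := by
    rw [hσ]
    simp [combinedSign]
  simp only [e]
  rw [h, Finset.abs_prod]
  exact Finset.prod_le_prod (fun _ _ => abs_nonneg _) fun j _ => abs_integral_sign_le (hS j) _ _ _ _

/-- The indicator of a collision of two different multi-indices. -/
def collision (H : (j : J) → Fin (I j) → Fin m) (i j : (j : J) → Fin (I j)) : ℝ :=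
  if i ≠ j ∧ combinedHash H i = combinedHash H j then 1 else 0

theorem collision_mem (H : (j : J) → Fin (I j) → Fin m) (i j : (j : J) → Fin (I j)) :
    0 ≤ collision H i j ∧ collision H i j ≤ 1 := by
  unfold collision
  split_ifs <;> norm_num

theorem tensorSketch_apply [DecidableEq J] (H : (j : J) → Fin (I j) → Fin m) (S : (j : J) → Fin (I j) → ℤˣ)
    (k : Fin m) (i : (j : J) → Fin (I j)) :
    tensorSketch H S k i = (if (k : ℕ) = combinedHash H i then 1 else 0) * combinedSign S i := by
  unfold tensorSketch bucketMatrix signMatrix combinedHash combinedSign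
  rw [Matrix.mul_diagonal]
  rfl

variable [NeZero m] {H : (j : J) → Fin (I j) → Ω → Fin m} {S : (j : J) → Fin (I j) → Ω → ℤˣ}

/-- One of the two collision factors is simply bounded by 1. -/
theorem integral_collision_mul_le (h : IsTensorSketchHash H S P) (x y z w : (j : J) → Fin (I j)) :
    |∫ ω, collision (fun j a => H j a ω) x y * collision (fun j a => H j a ω) z w ∂P| ≤
      (m : ℝ)⁻¹ := by
  have hmH := h.measurable_bucket
  rw [abs_of_nonneg (integral_nonneg fun ω => mul_nonneg (collision_mem _ _ _).1
    (collision_mem _ _ _).1)]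
  by_cases hxy : x = y
  · simp [collision, hxy]
  have hmeas : MeasurableSet {ω | combinedHash (fun j a => H j a ω) x =
      combinedHash (fun j a => H j a ω) y} :=
    hmH (MeasurableSet.of_discrete (s := {u | combinedHash u x = combinedHash u y}))
  refine le_trans ?_ (measure_combinedHash_eq_le h.bucket h.indep_bucket hxy)
  rw [← integral_indicator_one hmeas]
  refine integral_mono
    (integrable_comp_of_finite hmH fun u => collision u x y * collision u z w)
    ((integrable_const 1).indicator hmeas) fun ω => ?_
  refine (mul_le_of_le_one_right (collision_mem _ _ _).1 (collision_mem _ _ _).2).trans ?_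
  simp [collision, hxy, Set.indicator_apply]

variable [DecidableEq J]

/-- Buckets and signs are independent, so each term of the expanded square splits. The bound `1 / m`
on the bucket part is uniform, leaving the product of pairing kernels, which `IsQuadBound.pi`
controls on `|a|` and `|b|`. -/
theorem IsTensorSketchHash.integral_sq_le (h : IsTensorSketchHash H S P)
    (a b : ((j : J) → Fin (I j)) → ℝ) :
    ∫ ω, (∑ i, ∑ j, collision (fun j a => H j a ω) i j *
      (combinedSign (fun j a => S j a ω) i * combinedSign (fun j a => S j a ω) j) *
        (a i * b j)) ^ 2 ∂P ≤
      3 ^ Fintype.card J / m * ((∑ i, a i ^ 2) * ∑ i, b i ^ 2) := by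
  classical
  have hmH := h.measurable_bucket
  have hmS := h.measurable_sign
  let D := fun ω => collision fun j a => H j a ω
  let σ := fun ω => combinedSign fun j a => S j a ω
  have e₁ (ω : Ω) : (∑ i, ∑ j, D ω i j * (σ ω i * σ ω j) * (a i * b j)) ^ 2 =
      ∑ x, ∑ y, ∑ z, ∑ w, (D ω x y * D ω z w) * (σ ω x * σ ω y * σ ω z * σ ω w) *
        (a x * b y * a z * b w) := by
    rw [pow_two]
    simp only [Finset.sum_mul, Finset.mul_sum]
    refine Finset.sum_congr rfl fun x _ => Finset.sum_congr rfl fun y _ =>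
      Finset.sum_congr rfl fun z _ => Finset.sum_congr rfl fun w _ => by ring
  have hint (x y z w) : Integrable (fun ω => (D ω x y * D ω z w) *
      (σ ω x * σ ω y * σ ω z * σ ω w) * (a x * b y * a z * b w)) P :=
    integrable_comp_of_finite (hmH.prodMk hmS) fun u => (collision u.1 x y * collision u.1 z w) *
      (combinedSign u.2 x * combinedSign u.2 y * combinedSign u.2 z * combinedSign u.2 w) *
      (a x * b y * a z * b w)
  have e₂ (x y z w) : ∫ ω, (D ω x y * D ω z w) * (σ ω x * σ ω y * σ ω z * σ ω w) *
      (a x * b y * a z * b w) ∂P =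
      (∫ ω, D ω x y * D ω z w ∂P) * (∫ ω, σ ω x * σ ω y * σ ω z * σ ω w ∂P) *
      (a x * b y * a z * b w) := by
    rw [integral_mul_const]
    congr 1
    have hi := h.indep.comp (φ := fun u => collision u x y * collision u z w)
      (ψ := fun u => combinedSign u x * combinedSign u y * combinedSign u z * combinedSign u w)
      Measurable.of_discrete Measurable.of_discrete
    exact hi.integral_fun_mul_eq_mul_integral
      (Measurable.of_discrete.comp hmH).aestronglyMeasurable
      (Measurable.of_discrete.comp hmS).aestronglyMeasurable
  have e₃ (x y z w) : (∫ ω, D ω x y * D ω z w ∂P) * (∫ ω, σ ω x * σ ω y * σ ω z * σ ω w ∂P) *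
      (a x * b y * a z * b w) ≤ (m : ℝ)⁻¹ *
      ((∏ j, if Paired (x j) (y j) (z j) (w j) then 1 else 0) * (|a x| * |b y| * |a z| * |b w|)) := by
    refine (le_abs_self _).trans ?_
    rw [abs_mul, abs_mul, ← mul_assoc, abs_mul (_ * _), abs_mul (_ * _), abs_mul (a x)]
    refine mul_le_mul_of_nonneg_right (mul_le_mul (integral_collision_mul_le h x y z w)
      (abs_integral_combinedSign_le h.sign h.indep_sign (fun ω => rfl) x y z w) (abs_nonneg _)
      (by positivity)) (by positivity)
  have hq := (IsQuadBound.pi (fun j => Fin (I j)) _ fun j => isQuadBound_paired (Fin (I j))).le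
    (fun i => |a i|) (fun i => |b i|) (fun i => |a i|) (fun i => |b i|)
    (fun i => abs_nonneg _) (fun i => abs_nonneg _) (fun i => abs_nonneg _) (fun i => abs_nonneg _)
  have hl (f : ((j : J) → Fin (I j)) → ℝ) : l2 (fun i => |f i|) ^ 2 = ∑ i, f i ^ 2 := by
    simp [sq_l2]
  calc ∫ ω, (∑ i, ∑ j, D ω i j * (σ ω i * σ ω j) * (a i * b j)) ^ 2 ∂P
    _ = ∑ x, ∑ y, ∑ z, ∑ w, ∫ ω, (D ω x y * D ω z w) * (σ ω x * σ ω y * σ ω z * σ ω w) *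
        (a x * b y * a z * b w) ∂P := by
        simp only [e₁]
        rw [integral_finsetSum _ fun x _ => integrable_finsetSum _ fun y _ =>
          integrable_finsetSum _ fun z _ => integrable_finsetSum _ fun w _ => hint x y z w]
        refine Finset.sum_congr rfl fun x _ => ?_
        rw [integral_finsetSum _ fun y _ =>
          integrable_finsetSum _ fun z _ => integrable_finsetSum _ fun w _ => hint x y z w]
        refine Finset.sum_congr rfl fun y _ => ?_
        rw [integral_finsetSum _ fun z _ => integrable_finsetSum _ fun w _ => hint x y z w]
        refine Finset.sum_congr rfl fun z _ => ?_
        rw [integral_finsetSum _ fun w _ => hint x y z w]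
    _ ≤ ∑ x, ∑ y, ∑ z, ∑ w, (m : ℝ)⁻¹ * ((∏ j, if Paired (x j) (y j) (z j) (w j) then 1 else 0) *
        (|a x| * |b y| * |a z| * |b w|)) :=
      Finset.sum_le_sum fun x _ => Finset.sum_le_sum fun y _ => Finset.sum_le_sum fun z _ =>
        Finset.sum_le_sum fun w _ => (e₂ x y z w).trans_le (e₃ x y z w)
    _ ≤ (m : ℝ)⁻¹ * (3 ^ Fintype.card J * ((l2 fun i => |a i|) * (l2 fun i => |b i|) *
        (l2 fun i => |a i|) * (l2 fun i => |b i|))) := by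
      simp only [← Finset.mul_sum]
      exact mul_le_mul_of_nonneg_left hq (by positivity)
    _ = _ := by
      rw [← hl a, ← hl b]
      ring

/-- Each column has a single entry `±1`: the diagonal of `Tᵀ T` is exactly 1, and only collisions
contribute off it. -/
theorem sum_tensorSketch_mul (H : (j : J) → Fin (I j) → Fin m)
    (S : (j : J) → Fin (I j) → ℤˣ) (i j : (j : J) → Fin (I j)) :
    ∑ k, tensorSketch H S k i * tensorSketch H S k j =
      collision H i j * (combinedSign S i * combinedSign S j) + if i = j then 1 else 0 := by
  have h : ∑ k : Fin m, (if (k : ℕ) = combinedHash H i then (1 : ℝ) else 0) *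
      (if (k : ℕ) = combinedHash H j then 1 else 0) =
      if combinedHash H i = combinedHash H j then 1 else 0 := by
    have hlt : combinedHash H i < m := Nat.mod_lt _ (Nat.pos_of_neZero m)
    rw [Finset.sum_eq_single ⟨_, hlt⟩]
    · simp
    · intro k _ hk
      rw [if_neg fun h => hk (Fin.ext h), zero_mul]
    · simp
  simp only [tensorSketch_apply, mul_mul_mul_comm _ (combinedSign S i)]
  rw [← Finset.sum_mul, h]
  unfold collision
  by_cases hij : i = j
  · subst hij
    simp [combinedSign_mul_self]
  · simp [hij]

theorem sketch_gram_sub_gram {r s : Type*} (H : (j : J) → Fin (I j) → Fin m)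
    (S : (j : J) → Fin (I j) → ℤˣ) (U : Matrix ((j : J) → Fin (I j)) r ℝ)
    (V : Matrix ((j : J) → Fin (I j)) s ℝ) (k : r) (l : s) :
    ((tensorSketch H S * U).transpose * (tensorSketch H S * V) - U.transpose * V) k l =
      ∑ i, ∑ j, collision H i j * (combinedSign S i * combinedSign S j) * (U i k * V j l) := by
  have h : ((tensorSketch H S * U).transpose * (tensorSketch H S * V)) k l =
      ∑ i, ∑ j, (∑ b, tensorSketch H S b i * tensorSketch H S b j) * (U i k * V j l) := by
    simp only [Matrix.mul_apply, Matrix.transpose_apply, Finset.sum_mul_sum]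
    simp only [Finset.sum_mul]
    rw [Finset.sum_comm]
    refine Finset.sum_congr rfl fun i _ => ?_
    rw [Finset.sum_comm]
    exact Finset.sum_congr rfl fun j _ => Finset.sum_congr rfl fun b _ => by ring
  rw [Matrix.sub_apply, h]
  simp only [sum_tensorSketch_mul, add_mul, Finset.sum_add_distrib]
  simp [Matrix.mul_apply]

end SecondMoment

/-! ### Approximate matrix multiplication and sketched least squares -/

section Sketching

attribute [local instance] Matrix.frobeniusNormedAddCommGroup

open Matrix

variable {J : Type} [Fintype J] [DecidableEq J] {I : J → ℕ} {m : ℕ} [NeZero m]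
  {Ω : Type*} [MeasurableSpace Ω] {P : Measure Ω} [IsProbabilityMeasure P]
  {H : (j : J) → Fin (I j) → Ω → Fin m} {S : (j : J) → Fin (I j) → Ω → ℤˣ}

/-- The approximate matrix multiplication property of TensorSketch. -/
theorem IsTensorSketchHash.measureReal_gram_le (h : IsTensorSketchHash H S P)
    {r s : Type*} [Fintype r] [Fintype s] (U : Matrix ((j : J) → Fin (I j)) r ℝ)
    (V : Matrix ((j : J) → Fin (I j)) s ℝ) {t : ℝ} (ht : 0 ≤ t)
    {T : Ω → Matrix (Fin m) ((j : J) → Fin (I j)) ℝ}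
    (hT : ∀ ω, T ω = tensorSketch (fun j a => H j a ω) (fun j a => S j a ω)) :
    t ^ 2 * P.real {ω | t < ‖(T ω * U)ᵀ * (T ω * V) - Uᵀ * V‖} ≤
      3 ^ Fintype.card J / m * (‖U‖ ^ 2 * ‖V‖ ^ 2) := by
  let F : ((j : J) → Fin (I j) → Fin m) × ((j : J) → Fin (I j) → ℤˣ) → r → s → ℝ := fun u k l =>
    ∑ i, ∑ j, collision u.1 i j * (combinedSign u.2 i * combinedSign u.2 j) * (U i k * V j l)
  let Y : Ω → ((j : J) → Fin (I j) → Fin m) × ((j : J) → Fin (I j) → ℤˣ) := fun ω =>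
    (fun j a => H j a ω, fun j a => S j a ω)
  have hY : Measurable Y := h.measurable_bucket.prodMk h.measurable_sign
  have hn (ω : Ω) : ‖(T ω * U)ᵀ * (T ω * V) - Uᵀ * V‖ ^ 2 = ∑ k, ∑ l, F (Y ω) k l ^ 2 := by
    rw [frobenius_norm_sq, hT]
    simp only [sketch_gram_sub_gram, F, Y]
  -- Markov's inequality for the squared norm.
  have hm := mul_meas_ge_le_integral_of_nonneg (μ := P)
    (f := fun ω => ‖(T ω * U)ᵀ * (T ω * V) - Uᵀ * V‖ ^ 2)
    (Filter.Eventually.of_forall fun ω => sq_nonneg _)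
    (by simp only [hn]; exact integrable_comp_of_finite hY fun u => ∑ k, ∑ l, F u k l ^ 2) (t ^ 2)
  refine (mul_le_mul_of_nonneg_left (measureReal_mono fun ω hω => ?_) (sq_nonneg t)).trans
    (hm.trans ?_)
  · exact pow_le_pow_left₀ ht (le_of_lt hω) 2
  · simp only [hn]
    rw [integral_finsetSum _ fun k _ => integrable_finsetSum _ fun l _ =>
      integrable_comp_of_finite hY fun u => F u k l ^ 2]
    have hb : ∀ k, ∫ ω, ∑ l, F (Y ω) k l ^ 2 ∂P ≤
        ∑ l, 3 ^ Fintype.card J / m * ((∑ i, U i k ^ 2) * ∑ i, V i l ^ 2) := fun k => by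
      rw [integral_finsetSum _ fun l _ => integrable_comp_of_finite hY fun u => F u k l ^ 2]
      exact Finset.sum_le_sum fun l _ => h.integral_sq_le (fun i => U i k) fun i => V i l
    refine (Finset.sum_le_sum fun k _ => hb k).trans (le_of_eq ?_)
    simp only [← Finset.mul_sum, ← Finset.sum_mul]
    rw [frobenius_norm_sq, frobenius_norm_sq, Finset.sum_comm, Finset.sum_comm (γ := s)]

/-- Sketched least squares: with `m` large enough, all solutions of the problem sketched by a
TensorSketch are near-optimal with high probability. -/
theorem IsTensorSketchHash.measureReal_lsResidual_ge (h : IsTensorSketchHash H S P)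
    {q r : Type*} [Fintype q] [Fintype r] [Nonempty q] (A : Matrix ((j : J) → Fin (I j)) q ℝ)
    (B : Matrix ((j : J) → Fin (I j)) r ℝ) {Z₀ : Matrix q r ℝ} (hZ₀ : Aᵀ * (A * Z₀ - B) = 0)
    {ε η : ℝ} (hε : 0 < ε) (hη : 0 < η)
    (hm : 8 * ((Fintype.card q * 3 ^ Fintype.card J) * (Fintype.card q + 1 / ε ^ 2) / η) ≤ (m : ℝ))
    {T : Ω → Matrix (Fin m) ((j : J) → Fin (I j)) ℝ}
    (hT : ∀ ω, T ω = tensorSketch (fun j a => H j a ω) (fun j a => S j a ω)) :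
    1 - η ≤ P.real {ω | ∀ Z, IsLSSolution (T ω * A) (T ω * B) Z →
      lsResidual A B Z ≤ (1 + 2 * ε) * lsResidual A B Z₀} := by
  obtain ⟨d, U, M, W, hd, hU, hM, hW⟩ := exists_orthonormal_factor A
  set E := A * Z₀ - B with hE
  have hUE : Uᵀ * E = 0 := by rw [hW, transpose_mul, Matrix.mul_assoc, hZ₀, Matrix.mul_zero]
  have hUn : ‖U‖ ^ 2 = d := by
    rw [frobenius_norm_sq_eq_trace, hU, trace_one, Fintype.card_fin]
  set D : ℝ := (Fintype.card q : ℝ)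
  set c : ℝ := 3 ^ Fintype.card J
  have hc : 0 < c := by positivity
  have hD : 0 < D := by simp only [D]; exact_mod_cast Fintype.card_pos
  have hdD : (d : ℝ) ≤ D := by simp only [D]; exact_mod_cast hd
  have hm0 : (0 : ℝ) < m := by exact_mod_cast Nat.pos_of_neZero m
  rw [← mul_div_assoc, div_le_iff₀ hη] at hm
  -- The two summands in the bound on `m` serve the two bad events: `D` for the Gram matrix of `U`,
  -- `1 / ε ^ 2` for the residual.
  have hm₁ : 8 * (D * c * D) ≤ m * η := by
    refine le_trans ?_ hm
    gcongr
    exact le_add_of_nonneg_right (by positivity)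
  have hm₂ : 8 * (D * c) ≤ m * η * ε ^ 2 := by
    have : 8 * (D * c * (1 / ε ^ 2)) ≤ m * η := by
      refine le_trans ?_ hm
      gcongr
      exact le_add_of_nonneg_left hD.le
    calc 8 * (D * c) = 8 * (D * c * (1 / ε ^ 2)) * ε ^ 2 := by field_simp
      _ ≤ _ := by gcongr
  -- With threshold `1 / 2` and `‖U‖² = d ≤ D`, Markov gives `4 c D² / m`; this is at most `η / 2`
  -- thanks to the constant 8.
  have p₁ : P.real {ω | 1 / 2 < ‖(T ω * U)ᵀ * (T ω * U) - Uᵀ * U‖} ≤ η / 2 := by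
    have := h.measureReal_gram_le U U (t := 1 / 2) (by norm_num) hT
    set p := P.real {ω | 1 / 2 < ‖(T ω * U)ᵀ * (T ω * U) - Uᵀ * U‖}
    rw [hUn, div_mul_eq_mul_div, le_div_iff₀ hm0] at this
    have h₃ : c * ((d : ℝ) * d) ≤ c * (D * D) := by gcongr
    have h₄ : p * m ≤ η / 2 * m := by linarith
    exact le_of_mul_le_mul_right h₄ hm0
  have p₂ : P.real {ω | ε * ‖E‖ < ‖(T ω * U)ᵀ * (T ω * E) - Uᵀ * E‖} ≤ η / 2 := by
    -- For a zero residual Markov says nothing, but the strict inequality makes the bad event empty.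
    rcases eq_or_ne E 0 with h0 | h0
    · simp only [h0, Matrix.mul_zero, sub_zero, norm_zero, mul_zero, lt_irrefl, Set.ofPred_false,
        measureReal_empty]
      positivity
    have hE0 : 0 < ‖E‖ ^ 2 := by have := norm_pos_iff.2 h0; positivity
    have := h.measureReal_gram_le U E (t := ε * ‖E‖) (by positivity) hT
    set p := P.real {ω | ε * ‖E‖ < ‖(T ω * U)ᵀ * (T ω * E) - Uᵀ * E‖}
    rw [hUn, mul_pow, mul_right_comm, ← mul_assoc] at this
    have := le_of_mul_le_mul_right this hE0
    rw [div_mul_eq_mul_div, le_div_iff₀ hm0] at this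
    have h₃ : c * (d : ℝ) ≤ c * D := by gcongr
    have h₄ : p * (ε ^ 2 * m) ≤ η / 2 * (ε ^ 2 * m) := by nlinarith [mul_pos hc hD]
    exact le_of_mul_le_mul_right h₄ (by positivity)
  have hcover : (Set.univ : Set Ω) ⊆ {ω | ∀ Z, IsLSSolution (T ω * A) (T ω * B) Z →
      lsResidual A B Z ≤ (1 + 2 * ε) * lsResidual A B Z₀} ∪
      ({ω | 1 / 2 < ‖(T ω * U)ᵀ * (T ω * U) - Uᵀ * U‖} ∪
        {ω | ε * ‖E‖ < ‖(T ω * U)ᵀ * (T ω * E) - Uᵀ * E‖}) := by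
    intro ω _
    by_cases h₁ : ω ∈ {ω | 1 / 2 < ‖(T ω * U)ᵀ * (T ω * U) - Uᵀ * U‖}
    · exact Or.inr (Or.inl h₁)
    by_cases h₂ : ω ∈ {ω | ε * ‖E‖ < ‖(T ω * U)ᵀ * (T ω * E) - Uᵀ * E‖}
    · exact Or.inr (Or.inr h₂)
    refine Or.inl fun Z hZ => ?_
    have h₁' : ‖(T ω * U)ᵀ * (T ω * U) - Uᵀ * U‖ ≤ 1 / 2 := not_lt.1 fun h => h₁ h
    have h₂' : ‖(T ω * U)ᵀ * (T ω * E) - Uᵀ * E‖ ≤ ε * ‖E‖ := not_lt.1 fun h => h₂ h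
    rw [hUE, sub_zero] at h₂'
    exact lsResidual_le_of_sketch hU hM hW (T ω) h₁' h₂' hZ
  have h₁ := (measureReal_mono (μ := P) hcover).trans (measureReal_union_le _ _)
  have h₂ := measureReal_union_le (μ := P) {ω | 1 / 2 < ‖(T ω * U)ᵀ * (T ω * U) - Uᵀ * U‖}
    {ω | ε * ‖E‖ < ‖(T ω * U)ᵀ * (T ω * E) - Uᵀ * E‖}
  rw [probReal_univ] at h₁
  linarith

end Sketching

/-! ### The main theorem -/

theorem theorem5p1 :
    ∃ C K : ℝ, 0 < C ∧ 0 < K ∧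
      ∀ (N : ℕ) [NeZero N] (I R : Fin N → ℕ)
        (G : (j : Fin N) → Fin (I j) → Matrix (Fin (R j)) (Fin (R (j + 1))) ℝ)
        (X : ((j : Fin N) → Fin (I j)) → ℝ) (n : Fin N)
        (ε η : ℝ), 0 < ε → ε < 1 → 0 < η → η < 1 →
      ∀ (m : ℕ),
        C * (((R n : ℝ) * R (n + 1) * 3 ^ (N - 1)) * ((R n : ℝ) * R (n + 1) + 1 / ε ^ 2) / η) ≤ m →
      ∀ (Ω : Type*) [MeasurableSpace Ω] (P : Measure Ω) [IsProbabilityMeasure P]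
        (H : (j : {j : Fin N // j ≠ n}) → Fin (I j) → Ω → Fin m)
        (S : (j : {j : Fin N // j ≠ n}) → Fin (I j) → Ω → ℤˣ),
        IsTensorSketchHash H S P →
      let A := subchainUnfolding G n
      let B := unfoldingTranspose X n
      let T : Ω → Matrix (Fin m) (MultiIdx I n) ℝ := fun ω =>
        tensorSketch (fun j a => H j a ω) (fun j a => S j a ω)
      (∀ ω, ∃ Zs, IsLSSolution (T ω * A) (T ω * B) Zs) ∧
      ∃ opt : ℝ, IsLeast (Set.range fun Z => lsResidual A B Z) opt ∧
        1 - η ≤ P.real {ω | ∀ Zs, IsLSSolution (T ω * A) (T ω * B) Zs →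
          (1 - K * ε) * opt ≤ lsResidual A B Zs ∧ lsResidual A B Zs ≤ (1 + K * ε) * opt} := by
  refine ⟨8, 2, by norm_num, by norm_num, ?_⟩
  intro N _ I R G X n ε η hε _ hη _ m hm Ω _ P _ H S h A B T
  obtain ⟨Z₀, hZ₀⟩ := exists_normal A B
  have hopt := isLSSolution_of_normal hZ₀
  refine ⟨fun ω => (exists_normal (T ω * A) (T ω * B)).imp fun Z hZ => isLSSolution_of_normal hZ,
    lsResidual A B Z₀, ⟨⟨Z₀, rfl⟩, Set.forall_mem_range.2 hopt⟩, ?_⟩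
  have hupper : 1 - η ≤ P.real {ω | ∀ Z, IsLSSolution (T ω * A) (T ω * B) Z →
      lsResidual A B Z ≤ (1 + 2 * ε) * lsResidual A B Z₀} := by
    -- If a rank is zero, the bound on `m` allows `m = 0`, but there is only one `Z`, so nothing is
    -- lost.
    rcases isEmpty_or_nonempty (Fin (R n) × Fin (R (n + 1))) with he | he
    · have huniv : {ω | ∀ Z, IsLSSolution (T ω * A) (T ω * B) Z →
          lsResidual A B Z ≤ (1 + 2 * ε) * lsResidual A B Z₀} = Set.univ := by
        refine Set.eq_univ_of_forall fun ω Z _ => ?_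
        rw [Subsingleton.elim Z Z₀]
        exact le_mul_of_one_le_left (lsResidual_nonneg _ _ _) (by linarith)
      rw [huniv, probReal_univ]
      linarith
    · have hq : (Fintype.card (Fin (R n) × Fin (R (n + 1))) : ℝ) = R n * R (n + 1) := by simp
      have hq0 : (0 : ℝ) < R n * R (n + 1) := by
        rw [← hq]
        exact_mod_cast Fintype.card_pos
      have hJ : Fintype.card {j : Fin N // j ≠ n} = N - 1 := by
        rw [Fintype.card_subtype_compl]
        simp
      have hm0 : (0 : ℝ) < m := lt_of_lt_of_le (by positivity) hm
      have : NeZero m := ⟨by exact_mod_cast hm0.ne'⟩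
      exact h.measureReal_lsResidual_ge A B hZ₀ hε hη (by rwa [hq, hJ]) fun ω => rfl
  -- The lower bound holds for every outcome, since no residual is below `opt`.
  refine hupper.trans (measureReal_mono fun ω hω Z hZ => ⟨?_, hω Z hZ⟩)
  refine le_trans ?_ (hopt Z)
  exact mul_le_of_le_one_left (lsResidual_nonneg _ _ _) (by linarith)
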